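/- For \(q\in(1,2)\) and \(x\in I_q=[0,\frac1{q-1}]\), a base \(q\) expansion of \(x\) is a sequence \((\epsilon_j)_{j\ge1}\in\{0,1\}^{\mathbb N}\) with \(x=\sum_{j=1}^\infty \epsilon_j q^{-j}\). Let \(\mathcal B_3\) be the set of \(q\in(1,2)\) for which some \(x\in I_q\) has exactly three base \(q\) expansions. For \(k\ge2\), let \(q_k\) be the unique number in \((1,2)\) with \(q_k^k-q_k^{k-1}-\cdots-q_k-1=0\). Theorem B. (a) For every integer \(k\ge10\) and every real \(q\), if \(|q-q_k|\le q_k^{-2k-6}\) then \(q\in\mathcal B_3\). (b) For every real \(q\), if \(0<q-q_9\le q_9^{-24}\) then \(q\in\mathcal B_3\). -/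

import Mathlib

/-- The set of base `q` expansions of `x`: all sequences `ε` of digits in `{0, 1}` with
`x = ∑ ε_j q^{-j}`, the sum over `j ≥ 1`. Sequences are indexed from `0` here, so that the digit
`ε j` carries the weight `q^{-(j+1)}`. -/
def expansions (q x : ℝ) : Set (ℕ → Fin 2) :=
  {ε | HasSum (fun j : ℕ => ((ε j : ℕ) : ℝ) * (q ^ (j + 1))⁻¹) x}

/-- The points of `I_q = [0, 1/(q-1)]` that have exactly `m` base `q` expansions. -/
def pointsWithExpansions (q : ℝ) (m : ℕ) : Set ℝ :=
  {x | x ∈ Set.Icc 0 (1 / (q - 1)) ∧ (expansions q x).encard = m}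

/-- The set `𝓑_m` of bases `q` in `(1, 2)` for which some point has exactly `m` expansions. -/
def basesWithExpansions (m : ℕ) : Set ℝ :=
  {q | q ∈ Set.Ioo (1 : ℝ) 2 ∧ (pointsWithExpansions q m).Nonempty}

/-- For `k ≥ 2` exactly one number in `(1, 2)` satisfies `x^k - x^{k-1} - ⋯ - x - 1 = 0`. -/
theorem existsUnique_kBonacci (k : ℕ) (hk : 2 ≤ k) :
    ∃! x : ℝ, x ∈ Set.Ioo (1 : ℝ) 2 ∧ x ^ k - ∑ i ∈ Finset.range k, x ^ i = 0 := by
  have hc : ContinuousOn (fun x : ℝ => x ^ k - ∑ i ∈ Finset.range k, x ^ i) (Set.Icc 1 2) := by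
    fun_prop
  have h1 : (1 : ℝ) ^ k - ∑ i ∈ Finset.range k, (1 : ℝ) ^ i < 0 := by
    have : (2 : ℝ) ≤ k := by exact_mod_cast hk
    simp
    linarith
  have h2 : 0 < (2 : ℝ) ^ k - ∑ i ∈ Finset.range k, (2 : ℝ) ^ i := by
    rw [geom_sum_eq (by norm_num)]
    norm_num
  obtain ⟨x, hx, hx0⟩ := intermediate_value_Ioo (by norm_num : (1 : ℝ) ≤ 2) hc ⟨h1, h2⟩
  have key : ∀ a b : ℝ, 1 < a → a < b → a ^ k - ∑ i ∈ Finset.range k, a ^ i = 0 →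
      b ^ k - ∑ i ∈ Finset.range k, b ^ i = 0 → False := by
    intro a b ha hab h h'
    have hlt : ∑ i ∈ Finset.range k, a ^ k * b ^ i < ∑ i ∈ Finset.range k, b ^ k * a ^ i := by
      apply Finset.sum_lt_sum_of_nonempty ⟨0, by simp; omega⟩
      intro i hi
      have hik : i < k := Finset.mem_range.1 hi
      obtain ⟨d, rfl⟩ := Nat.exists_eq_add_of_lt hik
      have hd : a ^ (d + 1) < b ^ (d + 1) := pow_lt_pow_left₀ hab (by linarith) (by omega)
      have hp : 0 < a ^ i * b ^ i := by
        have : 0 < a := by linarith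
        have : 0 < b := by linarith
        positivity
      calc a ^ (i + d + 1) * b ^ i = a ^ i * b ^ i * a ^ (d + 1) := by ring
        _ < a ^ i * b ^ i * b ^ (d + 1) := by gcongr
        _ = b ^ (i + d + 1) * a ^ i := by ring
    rw [← Finset.mul_sum, ← Finset.mul_sum, ← sub_eq_zero.1 h, ← sub_eq_zero.1 h', mul_comm] at hlt
    exact lt_irrefl _ hlt
  refine ⟨x, ⟨hx, hx0⟩, ?_⟩
  rintro y ⟨hy, hy0⟩
  rcases lt_trichotomy y x with h | h | h
  · exact (key y x hy.1 h hy0 hx0).elim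
  · exact h
  · exact (key x y hx.1 h hx0 hy0).elim

/-- The `k`-Bonacci number `q_k`, for `k ≥ 2`: the unique number in `(1, 2)` that satisfies
`x^k - x^{k-1} - ⋯ - x - 1 = 0`. The value for `k < 2` is a placeholder. -/
noncomputable def kBonacci (k : ℕ) : ℝ :=
  if hk : 2 ≤ k then (existsUnique_kBonacci k hk).choose else 0

/-- The defining property of `q_k`. -/
theorem kBonacci_spec (k : ℕ) (hk : 2 ≤ k) :
    kBonacci k ∈ Set.Ioo (1 : ℝ) 2 ∧
      kBonacci k ^ k - ∑ i ∈ Finset.range k, kBonacci k ^ i = 0 := by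
  unfold kBonacci
  rw [dif_pos hk]
  exact (existsUnique_kBonacci k hk).choose_spec.1

/-!
For `q = q_k` the digit strings `1 0^k` and `0 1^k` have the same value, so for any tail `w` that
is a unique expansion and has no long runs, `1 0^(2k) w = 0 1^k 0^k w = 0 1^(k-1) 0 1^k w` is a
point with three expansions. For `q` near `q_k` the two strings differ in value by a multiple of
the defect `δ = 1 - ∑_{j ≤ k} q^{-j}`, and the three expansions survive once the tails are allowed
to differ: they must have values `v₀`, `v₁ = v₀ + q^k δ` and `v₂ = v₀ - q^(2k) δ`. The radius
`q_k^(-2k-6)` is such that these differences stay small (`defect_bounds`).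

Tails with small prescribed differences are constructed in `exists_three_sequences`. For `q` close
to `2`, the nonconstant blocks of five digits behave like the digits `1, …, 30` in base
`q^5 ≈ 32`. The two differences are expanded simultaneously in this base: three reals can be
rounded to integers so that the errors are within `2/3` of each other
(`exists_int_abs_sub_le_two_thirds`), which leaves remainders of the size that the next step can
handle. As every block contains both digits, no digit is repeated nine times in a row, and such a sequence
is a unique expansion for `q > q_9` (`digitValue_tail_mem_Ioo`, `encard_expansions_eq_one`).

Expansions are counted through the identity
`#expansions x = #expansions (q x) + #expansions (q x - 1)` (`encard_expansions`), in which one of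
the two terms vanishes unless `x` admits both first digits.
-/

open Finset Filter Topology

/-! ### Digit sequences and the number of expansions -/

/-- The value `∑ ε_j q^{-(j+1)}` of a digit sequence. -/
noncomputable def digitValue (q : ℝ) (ε : ℕ → Fin 2) : ℝ :=
  ∑' j : ℕ, ((ε j : ℕ) : ℝ) * (q ^ (j + 1))⁻¹

theorem hasSum_inv_pow_succ {q : ℝ} (hq : 1 < q) :
    HasSum (fun j : ℕ => (q ^ (j + 1))⁻¹) (1 / (q - 1)) := by
  have h0 : 0 < q := by linarith
  have h := (hasSum_geometric_of_lt_one (inv_nonneg.2 h0.le) (inv_lt_one_of_one_lt₀ hq)).mul_left q⁻¹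
  have h1 : q⁻¹ * (1 - q⁻¹)⁻¹ = 1 / (q - 1) := by
    have : q - 1 ≠ 0 := by linarith
    field_simp
  rw [h1] at h
  have e : (fun j : ℕ => (q ^ (j + 1))⁻¹) = fun j => q⁻¹ * q⁻¹ ^ j := by
    funext j
    rw [← inv_pow, pow_succ, mul_comm]
  rwa [e]

theorem mul_sum_inv_pow_succ {q : ℝ} (hq : 0 < q) (n : ℕ) :
    q * ∑ j ∈ range (n + 1), (q ^ (j + 1))⁻¹ = ∑ j ∈ range n, (q ^ (j + 1))⁻¹ + 1 := by
  rw [sum_range_succ', mul_add, mul_sum]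
  congr 1
  · refine sum_congr rfl fun j _ => ?_
    rw [pow_succ q (j + 1)]
    field_simp
  · simp [hq.ne']

theorem digit_cast_le_one (d : Fin 2) : ((d : ℕ) : ℝ) ≤ 1 := by
  have : (d : ℕ) ≤ 1 := by omega
  exact_mod_cast this

theorem hasSum_digitValue {q : ℝ} (hq : 1 < q) (ε : ℕ → Fin 2) :
    HasSum (fun j : ℕ => ((ε j : ℕ) : ℝ) * (q ^ (j + 1))⁻¹) (digitValue q ε) := by
  refine Summable.hasSum (Summable.of_nonneg_of_le (fun j => by positivity) (fun j => ?_)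
    (hasSum_inv_pow_succ hq).summable)
  have : 0 ≤ (q ^ (j + 1))⁻¹ := by positivity
  nlinarith [digit_cast_le_one (ε j)]

theorem mem_expansions_iff {q : ℝ} (hq : 1 < q) {x : ℝ} {ε : ℕ → Fin 2} :
    ε ∈ expansions q x ↔ digitValue q ε = x :=
  ⟨fun h => (hasSum_digitValue hq ε).unique h, fun h => h ▸ hasSum_digitValue hq ε⟩

theorem digitValue_mem_Icc {q : ℝ} (hq : 1 < q) (ε : ℕ → Fin 2) :
    digitValue q ε ∈ Set.Icc 0 (1 / (q - 1)) := by
  have h0 : 0 < q := by linarith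
  refine ⟨(hasSum_digitValue hq ε).nonneg fun j => by positivity,
    hasSum_le (fun j => ?_) (hasSum_digitValue hq ε) (hasSum_inv_pow_succ hq)⟩
  have : 0 ≤ (q ^ (j + 1))⁻¹ := by positivity
  nlinarith [digit_cast_le_one (ε j)]

/-- Reading off the first digit. -/
theorem digitValue_succ {q : ℝ} (hq : 1 < q) (ε : ℕ → Fin 2) :
    q * digitValue q ε = ((ε 0 : ℕ) : ℝ) + digitValue q (fun j => ε (j + 1)) := by
  have h0 : 0 < q := by linarith
  have h := (hasSum_digitValue hq ε).summable.tsum_eq_zero_add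
  have h2 : digitValue q (fun j => ε (j + 1)) =
      q * ∑' j : ℕ, ((ε (j + 1) : ℕ) : ℝ) * (q ^ (j + 1 + 1))⁻¹ := by
    rw [digitValue, ← tsum_mul_left]
    refine tsum_congr fun j => ?_
    rw [pow_succ q (j + 1)]
    field_simp
  rw [h2, digitValue, h, zero_add, pow_one, mul_add]
  field_simp

/-- Putting the digit `d` in front of a sequence. -/
def consDigit (d : Fin 2) (ε : ℕ → Fin 2) : ℕ → Fin 2
  | 0 => d
  | j + 1 => ε j

theorem consDigit_injective (d : Fin 2) : Function.Injective (consDigit d) := by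
  intro ε ε' h
  funext j
  exact congrFun h (j + 1)

/-- The expansions of `x` are those of `q x` behind a digit `0` and those of `q x - 1` behind a
digit `1`. -/
theorem encard_expansions {q : ℝ} (hq : 1 < q) (x : ℝ) :
    (expansions q x).encard = (expansions q (q * x)).encard + (expansions q (q * x - 1)).encard := by
  have h0 : q ≠ 0 := by linarith
  have hcons (d : Fin 2) (ε : ℕ → Fin 2) :
      q * digitValue q (consDigit d ε) = ((d : ℕ) : ℝ) + digitValue q ε :=
    digitValue_succ hq (consDigit d ε)
  have hU : expansions q x =
      consDigit 0 '' expansions q (q * x) ∪ consDigit 1 '' expansions q (q * x - 1) := by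
    ext ε
    simp only [Set.mem_union, Set.mem_image, mem_expansions_iff hq]
    constructor
    · intro h
      have hs := digitValue_succ hq ε
      rw [h] at hs
      have hε (d : Fin 2) (hd : ε 0 = d) : consDigit d (fun j => ε (j + 1)) = ε := by
        funext j
        cases j with
        | zero => exact hd.symm
        | succ j => rfl
      rcases Fin.exists_fin_two.1 ⟨ε 0, rfl⟩ with hd | hd
      · exact Or.inl ⟨_, by rw [hs, hd]; simp, hε 0 hd⟩
      · exact Or.inr ⟨_, by rw [hs, hd]; simp, hε 1 hd⟩
    · rintro (⟨η, h, rfl⟩ | ⟨η, h, rfl⟩)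
      · have := hcons 0 η
        rw [h] at this
        exact mul_left_cancel₀ h0 (by simpa using this)
      · have := hcons 1 η
        rw [h] at this
        exact mul_left_cancel₀ h0 (by simpa using this)
  rw [hU, Set.encard_union_eq, (consDigit_injective 0).encard_image,
    (consDigit_injective 1).encard_image]
  rw [Set.disjoint_left]
  rintro _ ⟨η, -, rfl⟩ ⟨η', -, h⟩
  exact absurd (congrFun h 0) (by simp [consDigit])

theorem expansions_eq_empty {q : ℝ} (hq : 1 < q) {x : ℝ} (hx : x < 0 ∨ 1 / (q - 1) < x) :
    expansions q x = ∅ := by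
  rw [Set.eq_empty_iff_forall_notMem]
  intro ε hε
  have h := digitValue_mem_Icc hq ε
  rw [(mem_expansions_iff hq).1 hε] at h
  rcases hx with hx | hx
  · exact absurd h.1 (not_le.2 hx)
  · exact absurd h.2 (not_le.2 hx)

/-- Leading zeros in front of a point below `1` are forced. -/
theorem encard_expansions_zeros {q : ℝ} (hq : 1 < q) {y : ℝ} (h0 : 0 ≤ y) (h1 : y < 1) (n : ℕ) :
    (expansions q ((q ^ n)⁻¹ * y)).encard = (expansions q y).encard := by
  have hq0 : 0 < q := by linarith
  induction n with
  | zero => simp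
  | succ n ih =>
    have hx : q * ((q ^ (n + 1))⁻¹ * y) = (q ^ n)⁻¹ * y := by
      rw [pow_succ]
      field_simp
    have hlt : (q ^ n)⁻¹ * y < 1 := by
      have : (q ^ n)⁻¹ ≤ 1 := inv_le_one_of_one_le₀ (one_le_pow₀ hq.le)
      nlinarith
    rw [encard_expansions hq, hx, ih,
      expansions_eq_empty hq (x := (q ^ n)⁻¹ * y - 1) (Or.inl (by linarith))]
    simp

/-- Leading ones in front of a point above `1 / (q - 1) - 1` are forced. -/
theorem encard_expansions_ones {q : ℝ} (hq : 1 < q) {y : ℝ} (h1 : 1 / (q - 1) - 1 < y) (n : ℕ) :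
    (expansions q (∑ j ∈ range n, (q ^ (j + 1))⁻¹ + (q ^ n)⁻¹ * y)).encard =
      (expansions q y).encard := by
  have hq0 : 0 < q := by linarith
  have hq1 : 0 < q - 1 := by linarith
  have hstep (n : ℕ) : q * (∑ j ∈ range (n + 1), (q ^ (j + 1))⁻¹ + (q ^ (n + 1))⁻¹ * y) =
      ∑ j ∈ range n, (q ^ (j + 1))⁻¹ + (q ^ n)⁻¹ * y + 1 := by
    rw [mul_add, mul_sum_inv_pow_succ hq0, pow_succ]
    field_simp
    ring
  have hgt (n : ℕ) : 1 / (q - 1) - 1 < ∑ j ∈ range n, (q ^ (j + 1))⁻¹ + (q ^ n)⁻¹ * y := by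
    induction n with
    | zero => simpa using h1
    | succ n ih =>
      have h := hstep n
      refine lt_of_mul_lt_mul_left ?_ hq0.le
      rw [h]
      have h2 : q * (1 / (q - 1) - 1) = 1 / (q - 1) + 1 - q := by field_simp; ring
      rw [h2]
      linarith
  induction n with
  | zero => simp
  | succ n ih =>
    rw [encard_expansions hq, hstep, add_sub_cancel_right, ih,
      expansions_eq_empty hq (Or.inr (by linarith [hgt n]))]
    simp

/-- A sequence has a unique expansion as its value when every tail lies strictly between the
thresholds at which the previous digit could be exchanged. -/
theorem encard_expansions_eq_one {q : ℝ} (hq : 1 < q) {w : ℕ → Fin 2}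
    (hw : ∀ n, digitValue q (fun j => w (j + n)) ∈ Set.Ioo (1 / (q - 1) - 1) 1) :
    (expansions q (digitValue q w)).encard = 1 := by
  have : expansions q (digitValue q w) = {w} := by
    ext ε
    rw [mem_expansions_iff hq, Set.mem_singleton_iff]
    refine ⟨fun h => ?_, fun h => h ▸ rfl⟩
    have hdigit (n : ℕ)
        (hn : digitValue q (fun j => ε (j + n)) = digitValue q (fun j => w (j + n))) :
        ε n = w n ∧
        digitValue q (fun j => ε (j + (n + 1))) = digitValue q (fun j => w (j + (n + 1))) := by
      have e1 := digitValue_succ hq (fun j => ε (j + n))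
      have e2 := digitValue_succ hq (fun j => w (j + n))
      simp only [zero_add, add_assoc, add_comm 1 n] at e1 e2
      have hb := digitValue_mem_Icc hq (fun j => ε (j + (n + 1)))
      have hw' := hw (n + 1)
      rw [hn] at e1
      have key : ε n = w n := by
        rcases Fin.exists_fin_two.1 ⟨ε n, rfl⟩ with h1 | h1 <;>
        rcases Fin.exists_fin_two.1 ⟨w n, rfl⟩ with h2 | h2 <;>
        rw [h1] at e1 ⊢ <;> rw [h2] at e2 ⊢ <;> simp at e1 e2
        · linarith [hb.2, hw'.1]
        · linarith [hb.1, hw'.2]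
      refine ⟨key, ?_⟩
      rw [key] at e1
      linarith
    have hall (n : ℕ) :
        digitValue q (fun j => ε (j + n)) = digitValue q (fun j => w (j + n)) := by
      induction n with
      | zero => exact h
      | succ n ih => exact (hdigit n ih).2
    funext n
    exact (hdigit n (hall n)).1
  rw [this, Set.encard_singleton]

/-! ### Sequences without long runs -/

theorem sum_inv_pow_succ {q : ℝ} (hq : 1 < q) (n : ℕ) :
    ∑ j ∈ range n, (q ^ (j + 1))⁻¹ = (1 - (q ^ n)⁻¹) / (q - 1) := by
  have hq0 : 0 < q := by linarith
  have hq1 : q - 1 ≠ 0 := by linarith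
  induction n with
  | zero => simp
  | succ n ih =>
    rw [sum_range_succ, ih]
    field_simp
    ring

/-- If the first `n` digits of a sequence contain a `0` and all tails have value at most `V`, then
replacing this `0` by a `1` and the tail behind it by nothing costs at most `(V - 1) / q`. -/
theorem digitValue_le_of_exists_zero {q : ℝ} (hq : 1 < q) {V : ℝ} (hV : 1 ≤ V) (n : ℕ) :
    ∀ w : ℕ → Fin 2, (∃ j < n, w j = 0) → (∀ m, digitValue q (fun j => w (j + m)) ≤ V) →
      digitValue q w ≤ ∑ j ∈ range n, (q ^ (j + 1))⁻¹ + q⁻¹ * (V - 1) := by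
  have hq0 : 0 < q := by linarith
  have hqi : 0 < q⁻¹ := by positivity
  induction n with
  | zero => rintro w ⟨j, hj, -⟩; omega
  | succ n ih =>
    rintro w ⟨j, hj, hj0⟩ hw
    have e := digitValue_succ hq w
    have hpos : 0 ≤ ∑ j ∈ range n, (q ^ (j + 1))⁻¹ := sum_nonneg fun j _ => by positivity
    refine le_of_mul_le_mul_left ?_ hq0
    rw [mul_add, mul_sum_inv_pow_succ hq0, e, mul_inv_cancel_left₀ hq0.ne']
    rcases j with _ | j
    · rw [hj0]
      have := hw 1
      simp
      linarith
    · have h1 := ih (fun j => w (j + 1)) ⟨j, by omega, hj0⟩ (fun m => by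
        simpa only [add_assoc, add_comm 1 m] using hw (m + 1))
      have h2 : q⁻¹ * (V - 1) ≤ V - 1 :=
        mul_le_of_le_one_left (by linarith) (inv_le_one_of_one_le₀ hq.le)
      linarith [digit_cast_le_one (w 0)]

/-- A sequence without `n` consecutive ones stays below `1` as soon as `q > q_n`, a condition
that reads `q ^ n * (2 - q) < 1`. -/
theorem digitValue_lt_one {q : ℝ} (hq : 1 < q) {n : ℕ} (hn : q ^ n * (2 - q) < 1)
    {w : ℕ → Fin 2} (hw : ∀ m, ∃ j < n, w (j + m) = 0) : digitValue q w < 1 := by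
  have hq0 : 0 < q := by linarith
  have hq1 : 0 < q - 1 := by linarith
  have hlt : ∑ j ∈ range n, (q ^ (j + 1))⁻¹ < 1 := by
    rw [sum_inv_pow_succ hq, div_lt_one hq1]
    have : 2 - q < (q ^ n)⁻¹ := by
      rw [← one_div, lt_div_iff₀ (by positivity)]
      linarith
    linarith
  have hstep {V : ℝ} (hV : 1 ≤ V) (h : ∀ m, digitValue q (fun j => w (j + m)) ≤ V) (m : ℕ) :
      digitValue q (fun j => w (j + m)) ≤
        ∑ j ∈ range n, (q ^ (j + 1))⁻¹ + q⁻¹ * (V - 1) :=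
    digitValue_le_of_exists_zero hq hV n _ (hw m) fun m' => by
      simpa only [add_assoc, add_comm m' m] using h (m' + m)
  -- Bounds by `V` improve to bounds by `1 + (V - 1) / q`, hence the tails are at most `1`.
  have hiter (i : ℕ) : ∀ m, digitValue q (fun j => w (j + m)) ≤ 1 + q⁻¹ ^ i * (1 / (q - 1)) := by
    induction i with
    | zero => intro m; have := (digitValue_mem_Icc hq (fun j => w (j + m))).2; simp at this ⊢; linarith
    | succ i ih =>
      intro m
      have hp : 0 ≤ q⁻¹ ^ i * (1 / (q - 1)) := by positivity
      refine (hstep (by linarith) ih m).trans ?_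
      rw [pow_succ]
      linarith
  have hle (m : ℕ) : digitValue q (fun j => w (j + m)) ≤ 1 := by
    have hlim : Tendsto (fun i : ℕ => 1 + q⁻¹ ^ i * (1 / (q - 1))) atTop
        (𝓝 (1 + 0 * (1 / (q - 1)))) :=
      ((tendsto_pow_atTop_nhds_zero_of_lt_one (by positivity)
        (inv_lt_one_of_one_lt₀ hq)).mul_const _).const_add 1
    have := ge_of_tendsto' hlim fun i => hiter i m
    simpa using this
  have := hstep le_rfl hle 0
  simp only [add_zero, sub_self, mul_zero] at this
  exact this.trans_lt hlt

theorem digitValue_rev {q : ℝ} (hq : 1 < q) (w : ℕ → Fin 2) :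
    digitValue q (fun j => (w j).rev) = 1 / (q - 1) - digitValue q w := by
  have h (j : ℕ) : (((w j).rev : ℕ) : ℝ) * (q ^ (j + 1))⁻¹ =
      (q ^ (j + 1))⁻¹ - ((w j : ℕ) : ℝ) * (q ^ (j + 1))⁻¹ := by
    rcases Fin.exists_fin_two.1 ⟨w j, rfl⟩ with h | h <;> simp [h]
  rw [digitValue, tsum_congr h]
  exact ((hasSum_inv_pow_succ hq).sub (hasSum_digitValue hq w)).tsum_eq

/-- For `q > q_n`, the sequences in which no digit is repeated `n` times in a row satisfy the
criterion of `encard_expansions_eq_one`. -/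
theorem digitValue_tail_mem_Ioo {q : ℝ} (hq : 1 < q) {n : ℕ} (hn : q ^ n * (2 - q) < 1)
    {w : ℕ → Fin 2} (hw : ∀ d : Fin 2, ∀ m, ∃ j < n, w (j + m) = d) (m : ℕ) :
    digitValue q (fun j => w (j + m)) ∈ Set.Ioo (1 / (q - 1) - 1) 1 := by
  constructor
  · have := digitValue_lt_one hq hn (w := fun j => (w (j + m)).rev) fun m' => by
      obtain ⟨j, hj, h⟩ := hw 1 (m' + m)
      exact ⟨j, hj, by rw [add_assoc, h]; rfl⟩
    rw [digitValue_rev hq] at this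
    linarith
  · exact digitValue_lt_one hq hn fun m' => by
      simpa only [add_assoc] using hw 0 (m' + m)

/-! ### Prescribed differences of three sequences without long runs -/

/-- Three reals can be moved by integers to within `2/3` of each other: cut the circle at an arc
of length at least `1/3` that contains none of them. -/
theorem exists_int_abs_sub_le_two_thirds (s t : ℝ) :
    ∃ a b : ℤ, |s - a| ≤ 2 / 3 ∧ |t - b| ≤ 2 / 3 ∧ |(s - a) - (t - b)| ≤ 2 / 3 := by
  have hs0 := Int.fract_nonneg s
  have hs1 := Int.fract_lt_one s
  have ht0 := Int.fract_nonneg t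
  have ht1 := Int.fract_lt_one t
  simp only [Int.fract] at hs0 hs1 ht0 ht1
  simp only [abs_le]
  rcases le_total (s - ⌊s⌋) (2 / 3) with hs | hs <;> rcases le_total (t - ⌊t⌋) (2 / 3) with ht | ht
  · exact ⟨⌊s⌋, ⌊t⌋, by constructor <;> linarith, by constructor <;> linarith,
      by constructor <;> linarith⟩
  · rcases le_total (s - ⌊s⌋) (1 / 3) with hs' | hs'
    · exact ⟨⌊s⌋, ⌊t⌋ + 1, by constructor <;> linarith, by push_cast; constructor <;> linarith,
        by push_cast; constructor <;> linarith⟩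
    · exact ⟨⌊s⌋ + 1, ⌊t⌋ + 1, by push_cast; constructor <;> linarith,
        by push_cast; constructor <;> linarith, by push_cast; constructor <;> linarith⟩
  · rcases le_total (t - ⌊t⌋) (1 / 3) with ht' | ht'
    · exact ⟨⌊s⌋ + 1, ⌊t⌋, by push_cast; constructor <;> linarith, by constructor <;> linarith,
        by push_cast; constructor <;> linarith⟩
    · exact ⟨⌊s⌋ + 1, ⌊t⌋ + 1, by push_cast; constructor <;> linarith,
        by push_cast; constructor <;> linarith, by push_cast; constructor <;> linarith⟩
  · exact ⟨⌊s⌋ + 1, ⌊t⌋ + 1, by push_cast; constructor <;> linarith,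
      by push_cast; constructor <;> linarith, by push_cast; constructor <;> linarith⟩

/-- The value `∑ c_i q^{4-i}` of a block of five digits. -/
def blockValue (q : ℝ) (c : Fin 5 → Fin 2) : ℝ :=
  ∑ i : Fin 5, ((c i : ℕ) : ℝ) * q ^ (4 - (i : ℕ))

/-- Near `q = 2` the nonconstant blocks have nearly the values `1, …, 30`. -/
theorem exists_nonconstant_block {q : ℝ} (h1 : 1.9978 < q) (h2 : q < 2) {m : ℤ} (hm1 : 1 ≤ m)
    (hm2 : m ≤ 30) :
    ∃ c : Fin 5 → Fin 2, (∀ d, ∃ i, c i = d) ∧ (m : ℝ) - 0.11 ≤ blockValue q c ∧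
      blockValue q c ≤ m := by
  have hv : ∃ c : Fin 5 → Fin 2, (∀ d, ∃ i, c i = d) ∧
      (16 * (c 0 : ℕ) + 8 * (c 1 : ℕ) + 4 * (c 2 : ℕ) + 2 * (c 3 : ℕ) + (c 4 : ℕ) : ℤ) = m := by
    revert m
    have : ∀ m ∈ Finset.Icc (1 : ℤ) 30, ∃ c : Fin 5 → Fin 2, (∀ d, ∃ i, c i = d) ∧
      (16 * (c 0 : ℕ) + 8 * (c 1 : ℕ) + 4 * (c 2 : ℕ) + 2 * (c 3 : ℕ) + (c 4 : ℕ) : ℤ) = m := by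
      decide +kernel
    exact fun m h h' => this m (Finset.mem_Icc.2 ⟨h, h'⟩)
  obtain ⟨c, hc, rfl⟩ := hv
  refine ⟨c, hc, ?_⟩
  have hd (i : Fin 5) : 0 ≤ ((c i : ℕ) : ℝ) ∧ ((c i : ℕ) : ℝ) ≤ 1 :=
    ⟨by positivity, digit_cast_le_one _⟩
  have b2 : 3.9912 ≤ q ^ 2 ∧ q ^ 2 ≤ 4 := by constructor <;> nlinarith
  have b3 : 7.9736 ≤ q ^ 3 ∧ q ^ 3 ≤ 8 := by
    rw [pow_succ]; constructor <;> nlinarith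
  have b4 : 15.9297 ≤ q ^ 4 ∧ q ^ 4 ≤ 16 := by
    rw [show q ^ 4 = q ^ 2 * q ^ 2 by ring]; constructor <;> nlinarith
  have e : blockValue q c = (c 0 : ℕ) * q ^ 4 + (c 1 : ℕ) * q ^ 3 + (c 2 : ℕ) * q ^ 2 +
      (c 3 : ℕ) * q + (c 4 : ℕ) := by
    simp [blockValue, Fin.sum_univ_five]
  rw [e]
  push_cast
  constructor <;> nlinarith [hd 0, hd 1, hd 2, hd 3]

/-- The differences `(s, t)` that the construction can realise. -/
def IsSmallPair (p : ℝ × ℝ) : Prop :=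
  |p.1| ≤ 0.8 ∧ |p.2| ≤ 0.8 ∧ |p.1 - p.2| ≤ 0.8

/-- One step of a base `q ^ 5` expansion of two differences at once: three nonconstant blocks
leave small remainders. -/
theorem exists_blocks_of_isSmallPair {q : ℝ} (h1 : 1.9978 < q) (h2 : q < 2) {p : ℝ × ℝ}
    (hp : IsSmallPair p) :
    ∃ c : Fin 3 → Fin 5 → Fin 2, (∀ k d, ∃ i, c k i = d) ∧
      IsSmallPair (q ^ 5 * p.1 - (blockValue q (c 1) - blockValue q (c 0)),
        q ^ 5 * p.2 - (blockValue q (c 2) - blockValue q (c 0))) := by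
  obtain ⟨s, t⟩ := p
  obtain ⟨hs, ht, hst⟩ := hp
  simp only at hs ht hst
  have hq5 : 0 ≤ q ^ 5 ∧ q ^ 5 ≤ 32 := by
    refine ⟨by positivity, ?_⟩
    calc q ^ 5 ≤ 2 ^ 5 := by gcongr
      _ = 32 := by norm_num
  have hbig {u : ℝ} (hu : |u| ≤ 0.8) : |q ^ 5 * u| ≤ 25.6 := by
    rw [abs_mul, abs_of_nonneg hq5.1]
    nlinarith [abs_nonneg u]
  have hs' := hbig hs
  have ht' := hbig ht
  have hst' := hbig hst
  obtain ⟨a, b, ha, hb, hab⟩ := exists_int_abs_sub_le_two_thirds (q ^ 5 * s) (q ^ 5 * t)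
  rw [mul_sub] at hst'
  rw [abs_le] at hs' ht' hst' ha hb hab
  have ha1 : -27 < a ∧ a < 27 := by
    constructor <;> (rify; linarith)
  have hb1 : -27 < b ∧ b < 27 := by
    constructor <;> (rify; linarith)
  have hab1 : -27 < a - b ∧ a - b < 27 := by
    constructor <;> (rify; linarith)
  -- A common shift brings the three digits `0`, `a`, `b` into `1, …, 30`.
  obtain ⟨m, hm0, hm1, hm2⟩ : ∃ m : ℤ, (1 ≤ m ∧ m ≤ 30) ∧ (1 ≤ m + a ∧ m + a ≤ 30) ∧
      (1 ≤ m + b ∧ m + b ≤ 30) :=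
    ⟨1 - min 0 (min a b), by omega, by omega, by omega⟩
  obtain ⟨c0, hc0, l0, u0⟩ := exists_nonconstant_block h1 h2 hm0.1 hm0.2
  obtain ⟨c1, hc1, l1, u1⟩ := exists_nonconstant_block h1 h2 hm1.1 hm1.2
  obtain ⟨c2, hc2, l2, u2⟩ := exists_nonconstant_block h1 h2 hm2.1 hm2.2
  push_cast at l1 u1 l2 u2
  refine ⟨![c0, c1, c2], ?_, ?_⟩
  · intro k
    fin_cases k
    · exact hc0
    · exact hc1
    · exact hc2
  · simp only [IsSmallPair, abs_le, Matrix.cons_val_zero, Matrix.cons_val_one, Matrix.cons_val]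
    refine ⟨⟨?_, ?_⟩, ⟨?_, ?_⟩, ?_, ?_⟩ <;> linarith

theorem sum_range_five_mul {q : ℝ} (hq : 0 < q) {w : ℕ → Fin 2} {c : ℕ → Fin 5 → Fin 2}
    (hw : ∀ n (i : Fin 5), w (5 * n + i) = c n i) (N : ℕ) :
    ∑ j ∈ range (5 * N), ((w j : ℕ) : ℝ) * (q ^ (j + 1))⁻¹ =
      ∑ n ∈ range N, ((q ^ 5) ^ (n + 1))⁻¹ * blockValue q (c n) := by
  induction N with
  | zero => simp
  | succ N ih =>
    rw [sum_range_succ, ← ih, show 5 * (N + 1) = 5 * N + 5 by ring, sum_range_add]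
    congr 1
    rw [blockValue, Finset.sum_range, mul_sum]
    refine sum_congr rfl fun i _ => ?_
    rw [hw, ← pow_mul]
    have : q ^ (5 * (N + 1)) = q ^ (5 * N + (i : ℕ) + 1) * q ^ (4 - (i : ℕ)) := by
      rw [← pow_add]
      congr 1
      omega
    rw [this]
    field_simp

/-- For `q` close to `2`, small differences can be realised by the values of three sequences
none of which repeats a digit nine times in a row. -/
theorem exists_three_sequences {q : ℝ} (h1 : 1.9978 < q) (h2 : q < 2) {s t : ℝ}
    (hst : IsSmallPair (s, t)) :
    ∃ w : Fin 3 → ℕ → Fin 2, (∀ k d m, ∃ j < 9, w k (j + m) = d) ∧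
      digitValue q (w 1) - digitValue q (w 0) = s ∧
      digitValue q (w 2) - digitValue q (w 0) = t := by
  have hq : 1 < q := by linarith
  have hq0 : 0 < q := by linarith
  choose! c hc hnext using fun p => @exists_blocks_of_isSmallPair q h1 h2 p
  let next : ℝ × ℝ → ℝ × ℝ := fun p =>
    (q ^ 5 * p.1 - (blockValue q (c p 1) - blockValue q (c p 0)),
      q ^ 5 * p.2 - (blockValue q (c p 2) - blockValue q (c p 0)))
  -- The remainders after `n` blocks.
  let r : ℕ → ℝ × ℝ := fun n => next^[n] (s, t)
  have hr1 (n : ℕ) : r (n + 1) = next (r n) := Function.iterate_succ_apply' next n (s, t)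
  have hr (n : ℕ) : IsSmallPair (r n) := by
    induction n with
    | zero => exact hst
    | succ n ih => rw [hr1]; exact hnext _ ih
  let w : Fin 3 → ℕ → Fin 2 := fun k j => c (r (j / 5)) k ⟨j % 5, Nat.mod_lt _ (by norm_num)⟩
  have hw (k : Fin 3) (n : ℕ) (i : Fin 5) : w k (5 * n + i) = c (r n) k i := by
    have e1 : (5 * n + (i : ℕ)) / 5 = n := by omega
    have e2 : (5 * n + (i : ℕ)) % 5 = i := by omega
    simp only [w, e1, e2]
  have hsum (k : Fin 3) (N : ℕ) := sum_range_five_mul hq0 (hw k) N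
  have hlim (k : Fin 3) : Tendsto
      (fun N => ∑ n ∈ range N, ((q ^ 5) ^ (n + 1))⁻¹ * blockValue q (c (r n) k)) atTop
      (𝓝 (digitValue q (w k))) := by
    have h := (hasSum_digitValue hq (w k)).tendsto_sum_nat.comp
      (tendsto_id.const_mul_atTop' (by norm_num : 0 < 5))
    exact h.congr fun N => hsum k N
  have hq5 : 0 < q ^ 5 := by positivity
  have hsmall {f : ℝ × ℝ → ℝ} (hf : ∀ p, IsSmallPair p → |f p| ≤ 0.8) :
      Tendsto (fun N => ((q ^ 5) ^ N)⁻¹ * f (r N)) atTop (𝓝 0) := by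
    have h0 : Tendsto (fun N : ℕ => (q ^ 5)⁻¹ ^ N * 0.8) atTop (𝓝 (0 * 0.8)) :=
      (tendsto_pow_atTop_nhds_zero_of_lt_one (by positivity)
        (inv_lt_one_of_one_lt₀ (one_lt_pow₀ hq (by norm_num)))).mul_const _
    rw [zero_mul] at h0
    refine squeeze_zero_norm (fun N => ?_) h0
    rw [Real.norm_eq_abs, abs_mul, ← inv_pow, abs_of_nonneg (by positivity)]
    exact mul_le_mul_of_nonneg_left (hf _ (hr N)) (by positivity)
  have hdiff {f : ℝ × ℝ → ℝ} (hf : ∀ p, IsSmallPair p → |f p| ≤ 0.8) (k : Fin 3)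
      (hk : ∀ p, f (next p) = q ^ 5 * f p - (blockValue q (c p k) - blockValue q (c p 0))) :
      digitValue q (w k) - digitValue q (w 0) = f (s, t) := by
    have hpart (N : ℕ) : ∑ n ∈ range N, ((q ^ 5) ^ (n + 1))⁻¹ * blockValue q (c (r n) k) -
        ∑ n ∈ range N, ((q ^ 5) ^ (n + 1))⁻¹ * blockValue q (c (r n) 0) =
        f (s, t) - ((q ^ 5) ^ N)⁻¹ * f (r N) := by
      induction N with
      | zero => simp [r]
      | succ N ih =>
        rw [sum_range_succ, sum_range_succ, add_sub_add_comm, ih, hr1, hk, pow_succ (q ^ 5) N]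
        field_simp
        ring
    have hL := (hlim k).sub (hlim 0)
    simp only [hpart] at hL
    have hR := (hsmall hf).const_sub (f (s, t))
    rw [sub_zero] at hR
    exact tendsto_nhds_unique hL hR
  refine ⟨w, fun k d m => ?_, hdiff (f := Prod.fst) (fun p h => h.1) 1 fun p => rfl,
    hdiff (f := Prod.snd) (fun p h => h.2.1) 2 fun p => rfl⟩
  -- Nine consecutive positions contain a whole block.
  obtain ⟨i, hi⟩ := hc (r ((m + 4) / 5)) (hr _) k d
  have hi5 := i.isLt
  refine ⟨5 * ((m + 4) / 5) + i - m, by omega, ?_⟩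
  rw [Nat.sub_add_cancel (by omega), hw, hi]

/-! ### A point with three expansions -/

/-- If the defect `1 - ∑_{j ≤ k} q^{-j}` is small, then some sequences `w₀, w₁, w₂` without long
runs satisfy `1 0^(2k) w₂ = 0 1^k 0^k w₀ = 0 1^(k-1) 0 1^k w₁` in value, and the common value has
no further expansions. -/
theorem mem_basesWithExpansions_three {q : ℝ} (h1 : 1.9978 < q) (h2 : q < 2)
    (h9 : q ^ 9 * (2 - q) < 1) {k : ℕ} (hk : 1 ≤ k)
    (hd : q ^ (2 * k) * |1 - ∑ j ∈ range k, (q ^ (j + 1))⁻¹| ≤ 0.4) :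
    q ∈ basesWithExpansions 3 := by
  have hq : 1 < q := by linarith
  have hq0 : 0 < q := by linarith
  set S := ∑ j ∈ range k, (q ^ (j + 1))⁻¹ with hS
  have hQ1 : 1 ≤ q ^ k := one_le_pow₀ hq.le
  have hQ0 : 0 < q ^ k := by positivity
  rw [two_mul, pow_add] at hd
  have hsmall : IsSmallPair (q ^ k * (1 - S), -(q ^ k * q ^ k * (1 - S))) := by
    have e2 : |q ^ k * q ^ k * (1 - S)| ≤ 0.4 := by
      rwa [abs_mul, abs_of_pos (mul_pos hQ0 hQ0)]
    have e1 : |q ^ k * (1 - S)| ≤ 0.4 := by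
      rw [abs_mul, abs_of_pos hQ0]
      refine le_trans ?_ hd
      gcongr
      nlinarith
    rw [abs_le] at e1 e2
    refine ⟨abs_le.2 ⟨?_, ?_⟩, abs_le.2 ⟨?_, ?_⟩, abs_le.2 ⟨?_, ?_⟩⟩ <;> simp only <;> linarith
  obtain ⟨w, hw, hs, ht⟩ := exists_three_sequences h1 h2 hsmall
  have hone (i : Fin 3) := encard_expansions_eq_one hq (digitValue_tail_mem_Ioo hq h9 (hw i))
  have hmem (i : Fin 3) := digitValue_tail_mem_Ioo hq h9 (hw i) 0
  simp only [add_zero] at hmem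
  have hpos (i : Fin 3) : 0 ≤ digitValue q (w i) := (digitValue_mem_Icc hq _).1
  set v0 := digitValue q (w 0)
  set v1 := digitValue q (w 1)
  set v2 := digitValue q (w 2)
  -- The value of `1 0^k w₀ = 0 1^k w₁`.
  have hz : (expansions q (q⁻¹ * (1 + (q ^ k)⁻¹ * v0))).encard = 2 := by
    rw [encard_expansions hq, mul_inv_cancel_left₀ hq0.ne', add_sub_cancel_left,
      encard_expansions_zeros hq (hpos 0) (hmem 0).2, hone 0]
    have e : 1 + (q ^ k)⁻¹ * v0 = S + (q ^ k)⁻¹ * v1 := by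
      have : v1 = v0 + q ^ k * (1 - S) := by linarith
      rw [this]
      field_simp
      ring
    rw [e, encard_expansions_ones hq (hmem 1).1, hone 1]
    norm_num
  have hc : 1 / (q - 1) - 1 < q⁻¹ * (1 + (q ^ k)⁻¹ * v0) := by
    have a1 : 1 / (q - 1) - 1 < 1 / 2 := by
      rw [sub_lt_iff_lt_add, div_lt_iff₀ (by linarith)]
      linarith
    have a2 : 1 / 2 < q⁻¹ := by
      rw [← one_div]
      exact one_div_lt_one_div_of_lt hq0 h2
    have a3 : q⁻¹ * 1 ≤ q⁻¹ * (1 + (q ^ k)⁻¹ * v0) := by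
      gcongr
      have := hpos 0
      have : 0 ≤ (q ^ k)⁻¹ * v0 := by positivity
      linarith
    linarith
  -- The value of `1^k 0^k w₀ = 1^(k-1) 0 1^k w₁`; it exceeds that of `0^(2k) w₂` by `1`.
  have hy : (expansions q (S + (q ^ k)⁻¹ * ((q ^ k)⁻¹ * v0))).encard = 2 := by
    rw [← hz, ← encard_expansions_ones hq hc (k - 1)]
    congr 2
    obtain ⟨m, rfl⟩ : ∃ m, k = m + 1 := ⟨k - 1, by omega⟩
    rw [hS, sum_range_succ, Nat.add_sub_cancel]
    field_simp
    ring
  have hy' : S + (q ^ k)⁻¹ * ((q ^ k)⁻¹ * v0) - 1 = (q ^ (2 * k))⁻¹ * v2 := by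
    have : v2 = v0 - q ^ k * q ^ k * (1 - S) := by linarith
    rw [this, two_mul, pow_add]
    field_simp
    ring
  have hx : (expansions q (q⁻¹ * (S + (q ^ k)⁻¹ * ((q ^ k)⁻¹ * v0)))).encard = 3 := by
    rw [encard_expansions hq, mul_inv_cancel_left₀ hq0.ne', hy, hy',
      encard_expansions_zeros hq (hpos 2) (hmem 2).2, hone 2]
    norm_num
  refine ⟨⟨hq, h2⟩, _, ?_, hx⟩
  have hne : (expansions q (q⁻¹ * (S + (q ^ k)⁻¹ * ((q ^ k)⁻¹ * v0)))).Nonempty := by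
    rw [← Set.encard_pos, hx]
    norm_num
  obtain ⟨ε, hε⟩ := hne
  rw [← (mem_expansions_iff hq).1 hε]
  exact digitValue_mem_Icc hq ε

/-! ### Bases near the `k`-Bonacci numbers -/

theorem kBonacci_pow_mul_two_sub {k : ℕ} (hk : 2 ≤ k) :
    kBonacci k ^ k * (2 - kBonacci k) = 1 := by
  obtain ⟨-, h⟩ := kBonacci_spec k hk
  have hg := geom_sum_mul (kBonacci k) k
  rw [← sub_eq_zero.1 h] at hg
  linarith

theorem lt_kBonacci {k : ℕ} (hk : 9 ≤ k) : 1.998 < kBonacci k := by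
  have hp1 := (kBonacci_spec k (by omega)).1.1
  have hp := kBonacci_pow_mul_two_sub (k := k) (by omega)
  set p := kBonacci k
  have hp0 : 0 < p := by linarith
  by_contra! hle
  -- The sums `∑_{j ≤ k} x^{-j}` decrease in `x`, and the sum at `1.998` still exceeds `1`.
  have hle' : ∑ j ∈ range k, ((1.998 : ℝ) ^ (j + 1))⁻¹ ≤ ∑ j ∈ range k, (p ^ (j + 1))⁻¹ := by
    gcongr
  have hpk : (p ^ k)⁻¹ = 2 - p := inv_eq_of_mul_eq_one_right hp
  have hsum : (1 - (p ^ k)⁻¹) / (p - 1) = 1 := by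
    rw [hpk, div_eq_one_iff_eq (by linarith)]
    ring
  rw [sum_inv_pow_succ (by norm_num), sum_inv_pow_succ hp1, hsum, div_le_one (by norm_num)] at hle'
  have h9 : ((1.998 : ℝ) ^ k)⁻¹ ≤ (1.998 ^ 9)⁻¹ := by
    gcongr
    norm_num
  have h9' : ((1.998 : ℝ) ^ 9)⁻¹ < 0.002 := by norm_num
  linarith

/-- In a neighbourhood of `q_k` of radius `q_k^(-2k-6)`, the ratio `q^k (2 - q)` is so close to `1`
that the defect of `q` is small even on the scale `q^(-2k)`. -/
theorem defect_bounds {k : ℕ} (hk : 9 ≤ k) {q : ℝ}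
    (h : |q - kBonacci k| ≤ kBonacci k ^ (-2 * (k : ℤ) - 6)) :
    1.9978 < q ∧ q < 2 ∧ q ^ k * (2 - q) ≤ 1.01 ∧
      q ^ (2 * k) * |1 - ∑ j ∈ range k, (q ^ (j + 1))⁻¹| ≤ 0.4 := by
  have hp := kBonacci_pow_mul_two_sub (k := k) (by omega)
  have hp1 := lt_kBonacci hk
  set p := kBonacci k
  have hp0 : 0 < p := by linarith
  set P := p ^ k with hP
  set η := q - p with hη
  have hP500 : 500 ≤ P := by
    calc (500 : ℝ) ≤ 1.998 ^ 9 := by norm_num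
      _ ≤ p ^ 9 := by gcongr
      _ ≤ P := pow_le_pow_right₀ (by linarith) hk
  have hkP : (k : ℝ) ≤ 2 * P := by
    have := one_add_mul_le_pow (a := p - 1) (by linarith) k
    rw [add_sub_cancel] at this
    have hk0 : (0 : ℝ) ≤ k := by positivity
    nlinarith
  have hηP : P * (P * |η|) ≤ 1 / 63 := by
    have e : p ^ (-2 * (k : ℤ) - 6) = (P * P * p ^ 6)⁻¹ := by
      rw [hP, ← pow_add, ← pow_add, ← zpow_natCast, ← zpow_neg]
      congr 1
      push_cast
      ring
    rw [e] at h
    have h6 : 63 ≤ p ^ 6 := by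
      calc (63 : ℝ) ≤ 1.998 ^ 6 := by norm_num
        _ ≤ p ^ 6 := by gcongr
    calc P * (P * |η|) ≤ P * (P * (P * P * p ^ 6)⁻¹) := by gcongr
      _ = 1 / p ^ 6 := by field_simp
      _ ≤ 1 / 63 := one_div_le_one_div_of_le (by norm_num) h6
  set e := P * |η| with he
  have he0 : 0 ≤ e := by positivity
  have he1 : e ≤ 1 / 31500 := by nlinarith
  have hη1 : |η| ≤ e / 500 := by
    have := abs_nonneg η
    rw [le_div_iff₀ (by norm_num)]
    nlinarith
  have hkη : k * |η| ≤ 2 * e := by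
    calc k * |η| ≤ 2 * P * |η| := by gcongr
      _ = 2 * e := by rw [he]; ring
  have hηb := abs_le.1 (le_refl |η|)
  have hqp : q = p + η := by rw [hη]; ring
  have hq1 : 1.9978 < q := by linarith
  have hq0 : 0 < q := by linarith
  have hPη : |P * η| = e := by rw [abs_mul, abs_of_pos (by linarith : 0 < P)]
  have hPηb := abs_le.1 hPη.le
  have hq2 : q < 2 := by
    have : 0 < P * (2 - q) := by
      rw [hqp]
      linarith
    by_contra! h2
    nlinarith
  set ρ := q ^ k / P with hρ
  have hQ : q ^ k = ρ * P := by rw [hρ]; field_simp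
  have hlow : 1 - 2 * e ≤ ρ := by
    have := one_add_mul_le_pow (a := -|η|) (by linarith) k
    calc 1 - 2 * e ≤ (1 + -|η|) ^ k := by linarith
      _ ≤ (q / p) ^ k := by
        refine pow_le_pow_left₀ (by linarith) ?_ k
        rw [le_div_iff₀ hp0]
        nlinarith [abs_nonneg η]
      _ = ρ := by rw [div_pow]
  have hupp : ρ ≤ 1 + 3 * e := by
    have h1 := one_add_mul_le_pow (a := -|η|) (by linarith) k
    have h2 : (1 - 2 * e) * ρ ≤ 1 := by
      calc (1 - 2 * e) * ρ ≤ (1 + -|η|) ^ k * (q / p) ^ k := by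
            rw [div_pow]
            gcongr
            linarith
        _ = ((1 + -|η|) * (q / p)) ^ k := (mul_pow _ _ _).symm
        _ ≤ 1 := by
          refine pow_le_one₀ (mul_nonneg (by linarith) (by positivity)) ?_
          rw [← mul_div_assoc, div_le_one hp0]
          nlinarith [abs_nonneg η]
    nlinarith
  have hprod : q ^ k * (2 - q) = ρ * (1 - P * η) := by
    rw [hQ, hqp, ← hp]
    ring
  have hprod1 : |1 - q ^ k * (2 - q)| ≤ 5 * e := by
    rw [hprod, abs_le]
    constructor <;> nlinarith
  refine ⟨hq1, hq2, ?_, ?_⟩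
  · linarith [(abs_le.1 hprod1).1]
  · have hdef : (q - 1) * (q ^ k * (1 - ∑ j ∈ range k, (q ^ (j + 1))⁻¹)) =
        1 - q ^ k * (2 - q) := by
      have : q - 1 ≠ 0 := by linarith
      rw [sum_inv_pow_succ (by linarith)]
      field_simp
      ring
    have habs : q ^ k * |1 - ∑ j ∈ range k, (q ^ (j + 1))⁻¹| ≤ 6 * e := by
      rw [← hdef, abs_mul, abs_mul, abs_of_pos (by linarith : 0 < q - 1),
        abs_of_pos (by positivity : 0 < q ^ k)] at hprod1
      have : 0 ≤ q ^ k * |1 - ∑ j ∈ range k, (q ^ (j + 1))⁻¹| := by positivity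
      nlinarith
    rw [two_mul, pow_add, mul_assoc]
    calc q ^ k * (q ^ k * |1 - ∑ j ∈ range k, (q ^ (j + 1))⁻¹|) ≤ ρ * P * (6 * e) := by
          rw [← hQ]
          gcongr
      _ = ρ * (6 * (P * e)) := by ring
      _ ≤ 2 * (6 * (1 / 63)) := by gcongr; linarith
      _ ≤ 0.4 := by norm_num

theorem theoremB :
    (∀ k : ℕ, 10 ≤ k → ∀ q : ℝ,
      |q - kBonacci k| ≤ kBonacci k ^ (-2 * (k : ℤ) - 6) → q ∈ basesWithExpansions 3) ∧
    (∀ q : ℝ, 0 < q - kBonacci 9 → q - kBonacci 9 ≤ kBonacci 9 ^ (-24 : ℤ) →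
      q ∈ basesWithExpansions 3) := by
  constructor
  · intro k hk q h
    obtain ⟨h1, h2, h3, h4⟩ := defect_bounds (by omega) h
    refine mem_basesWithExpansions_three h1 h2 ?_ (by omega) h4
    -- Here `q` is well above `q_9`, since `q^k (2 - q)` is about `1` for some `k > 9`.
    have hk' : q ^ 9 * q ≤ q ^ k := by
      rw [← pow_succ]
      exact pow_le_pow_right₀ (by linarith) hk
    have : 0 ≤ q ^ 9 * (2 - q) := mul_nonneg (by positivity) (by linarith)
    nlinarith
  · intro q h0 h
    have hp := kBonacci_pow_mul_two_sub (k := 9) (by norm_num)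
    have hp1 := lt_kBonacci (k := 9) le_rfl
    obtain ⟨h1, h2, h3, h4⟩ := defect_bounds (k := 9) le_rfl (q := q)
      (by rw [abs_of_pos h0]; exact h)
    refine mem_basesWithExpansions_three h1 h2 ?_ (by norm_num) h4
    set p := kBonacci 9
    have hpow : q ^ 9 - p ^ 9 ≤ (q - p) * (9 * 2 ^ 8) := by
      have := abs_pow_sub_pow_le q p 9
      have hmax : max |q| |p| ≤ 2 := by
        rw [abs_of_pos (by linarith), abs_of_pos (by linarith)]
        exact max_le h2.le (by linarith)
      calc q ^ 9 - p ^ 9 ≤ |q ^ 9 - p ^ 9| := le_abs_self _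
        _ ≤ |q - p| * (9 : ℕ) * max |q| |p| ^ (9 - 1) := this
        _ ≤ (q - p) * (9 : ℕ) * 2 ^ (9 - 1) := by rw [abs_of_pos h0]; gcongr
        _ = (q - p) * (9 * 2 ^ 8) := by norm_num [mul_assoc]
    have hq9 : 500 ≤ q ^ 9 := by
      calc (500 : ℝ) ≤ 1.9978 ^ 9 := by norm_num
        _ ≤ q ^ 9 := by gcongr
    have h2p : 0 ≤ 2 - p := by linarith
    have e : q ^ 9 * (2 - q) = 1 + (q ^ 9 - p ^ 9) * (2 - p) - q ^ 9 * (q - p) := by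
      rw [← hp]
      ring
    have e1 : (q ^ 9 - p ^ 9) * (2 - p) ≤ (q - p) * (9 * 2 ^ 8) * 0.002 :=
      mul_le_mul hpow (by linarith) h2p (by positivity)
    have e2 : 500 * (q - p) ≤ q ^ 9 * (q - p) := by gcongr
    rw [e]
    linarith
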